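/- Let $f:(0,\infty)\to(0,\infty)$ be a matrix monotone function, i.e. for every $k$ and all positive definite $A,B\in M_k(\mathbb C)$, $A\le B$ implies $f(A)\le f(B)$. Equip $M_n(\mathbb C)$ with the Hilbert--Schmidt inner product $\langle A,B\rangle=\mathrm{Tr}\,A^*B$. For positive definite $D_1,D_2\in M_n(\mathbb C)$ let $\Delta(D_1/D_2)$ be the positive definite operator $B\mapsto D_1BD_2^{-1}$ on $M_n(\mathbb C)$, let $R_{D_2}B=BD_2$, and put $\mathbb J^f_{D_1,D_2}=f(\Delta(D_1/D_2))\,R_{D_2}$. Then for all positive definite $D_1,D_2$ the operator $\mathbb J^f_{D_1,D_2}$ is invertible, and for every $A\in M_n(\mathbb C)$ the generalized monotone metric $$\gamma^f_{D_1,D_2}(A,A)=\langle A,(\mathbb J^f_{D_1,D_2})^{-1}A\rangle$$ is real and is a jointly convex function of $(D_1,D_2)$: for positive definite $D_1,D_2,E_1,E_2\in M_n(\mathbb C)$ and $\lambda\in[0,1]$, $$\gamma^f_{\lambda D_1+(1-\lambda)E_1,\;\lambda D_2+(1-\lambda)E_2}(A,A)\le\lambda\,\gamma^f_{D_1,D_2}(A,A)+(1-\lambda)\,\gamma^f_{E_1,E_2}(A,A).$$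 -/

import Mathlib

open Matrix
open scoped ComplexOrder

noncomputable section

namespace QuasiEntropy

/-- A real function is *matrix monotone* on `(0, ∞)`: for every matrix size and all positive
definite complex matrices `A ≤ B` (Loewner order) one has `f(A) ≤ f(B)`. Here `cfc f A` is the
usual functional calculus of a Hermitian matrix; only the values of `f` on `(0, ∞)` matter. -/
def MatrixMonotone (f : ℝ → ℝ) : Prop :=
  ∀ (n : ℕ) (A B : Matrix (Fin n) (Fin n) ℂ), A.PosDef → B.PosDef →
    (B - A).PosSemidef → (cfc f B - cfc f A).PosSemidef

/-- The Hilbert-Schmidt inner product `⟨B, C⟩ = Tr B* C` on complex matrices. -/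
def hsInner {n : ℕ} (B C : Matrix (Fin n) (Fin n) ℂ) : ℂ :=
  (Bᴴ * C).trace

/-- The functional calculus `f(T)` of a linear operator `T` on the Hilbert space of `n × n`
matrices with the Hilbert-Schmidt inner product, `T` being self-adjoint for it: the functional
calculus is applied to the matrix of `T` in the orthonormal basis of matrix units. -/
def opFun {n : ℕ} (f : ℝ → ℝ) (T : Module.End ℂ (Matrix (Fin n) (Fin n) ℂ)) :
    Module.End ℂ (Matrix (Fin n) (Fin n) ℂ) :=
  Matrix.toLin (Matrix.stdBasis ℂ (Fin n) (Fin n)) (Matrix.stdBasis ℂ (Fin n) (Fin n))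
    (cfc f (LinearMap.toMatrix (Matrix.stdBasis ℂ (Fin n) (Fin n))
      (Matrix.stdBasis ℂ (Fin n) (Fin n)) T))

/-- The relative modular operator `Δ(D₁/D₂) B = D₁ B D₂⁻¹`. -/
def relModular {n : ℕ} (D₁ D₂ : Matrix (Fin n) (Fin n) ℂ) :
    Module.End ℂ (Matrix (Fin n) (Fin n) ℂ) :=
  LinearMap.mulLeft ℂ D₁ * LinearMap.mulRight ℂ D₂⁻¹

/-- The operator `J^f_{D₁,D₂} = f(Δ(D₁/D₂)) R_{D₂}`, where `R_{D₂} B = B D₂`. -/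
def opJ {n : ℕ} (f : ℝ → ℝ) (D₁ D₂ : Matrix (Fin n) (Fin n) ℂ) :
    Module.End ℂ (Matrix (Fin n) (Fin n) ℂ) :=
  opFun f (relModular D₁ D₂) * LinearMap.mulRight ℂ D₂

/-- The generalized (two-parameter) monotone metric
`γ^f_{D₁,D₂}(A, B) = ⟨A, (J^f_{D₁,D₂})⁻¹ B⟩`. The inverse is the one in the ring of linear
operators on the matrix space. -/
def genMetric {n : ℕ} (f : ℝ → ℝ) (D₁ D₂ A B : Matrix (Fin n) (Fin n) ℂ) : ℂ :=
  hsInner A (Ring.inverse (opJ f D₁ D₂) B)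

end QuasiEntropy

end

/-!
The operator `J = f(Δ) R` is, in the basis of matrix units, the perspective `f(X Y⁻¹) Y` of the
commuting positive definite matrices `X = D₁ ⊗ 1` and `Y = 1 ⊗ D₂ᵀ`, both of which depend linearly
on `(D₁, D₂)`. In particular `J` is positive definite, hence invertible, and the metric is the
quadratic form of `J⁻¹`. This form is a supremum of functions `2 Re ⟨x, v⟩ - ⟨x, J x⟩`, which are
affine and decreasing in `J` (`two_re_sub_le`), so joint convexity of the metric follows
(`re_dotProduct_inv_le`) from joint concavity of the perspective
(`MatrixMonotone.perspective_concave`).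

Joint concavity of the perspective is an instance of Jensen's inequality
`V* f(T) V ≤ f(V* T V)` for isometries `V` (`MatrixMonotone.jensen`). To deduce that from
monotonicity, let `P = V V*` and `Q = 1 - P`. Then `T ≤ S` for
`S = (1 + ε) P T P + (1 + ε⁻¹) Q T Q`, so `f(T) ≤ f(S)`; and `S V = V K` with
`K = (1 + ε) V* T V` gives `f(S) V = V f(K)`, whence `V* f(T) V ≤ f((1 + ε) V* T V)`. The two-point
case of this, in which the second term is positive and may be dropped, shows that `f(x) / x` is
decreasing. Hence `f((1 + ε) x) ≤ (1 + ε) f(x)`, and `ε` can tend to `0`.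
-/

noncomputable section

namespace QuasiEntropy

open Polynomial
open scoped Kronecker

variable {ι κ : Type*} [Fintype ι] [DecidableEq ι] [Fintype κ] [DecidableEq κ]
variable {f : ℝ → ℝ} {n : ℕ}

/-! ### Functional calculus of Hermitian matrices through polynomials -/

theorem exists_polynomial_eqOn {s : Set ℝ} (hs : s.Finite) (f : ℝ → ℝ) :
    ∃ p : ℝ[X], ∀ x ∈ s, p.eval x = f x := by
  classical
  refine ⟨Lagrange.interpolate hs.toFinset id f, fun x hx => ?_⟩
  exact Lagrange.eval_interpolate_at_node (v := id) f Function.injective_id.injOn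
    (hs.mem_toFinset.mpr hx)

theorem exists_polynomial_cfc (f : ℝ → ℝ) {S : Matrix ι ι ℂ} {K : Matrix κ κ ℂ}
    (hS : S.IsHermitian) (hK : K.IsHermitian) :
    ∃ p : ℝ[X], cfc f S = aeval S p ∧ cfc f K = aeval K p := by
  obtain ⟨p, hp⟩ := exists_polynomial_eqOn
    ((S.finite_real_spectrum).union K.finite_real_spectrum) f
  refine ⟨p, ?_, ?_⟩
  · rw [← cfc_polynomial p S hS.isSelfAdjoint]
    exact cfc_congr fun x hx => (hp x (Or.inl hx)).symm
  · rw [← cfc_polynomial p K hK.isSelfAdjoint]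
    exact cfc_congr fun x hx => (hp x (Or.inr hx)).symm

theorem aeval_mul_of_intertwine (p : ℝ[X]) {S : Matrix κ κ ℂ} {K : Matrix ι ι ℂ}
    {V : Matrix κ ι ℂ} (h : S * V = V * K) : aeval S p * V = V * aeval K p := by
  induction p using Polynomial.induction_on' with
  | add p q hp hq => simp [Matrix.add_mul, Matrix.mul_add, hp, hq]
  | monomial k a =>
    have hk : S ^ k * V = V * K ^ k := by
      induction k with
      | zero => simp
      | succ k ih => rw [pow_succ, Matrix.mul_assoc, h, ← Matrix.mul_assoc, ih, pow_succ,
          Matrix.mul_assoc]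
    rw [aeval_monomial, aeval_monomial, ← Algebra.smul_def, ← Algebra.smul_def,
      Matrix.smul_mul, Matrix.mul_smul, hk]

/-- An intertwiner of two Hermitian matrices also intertwines their images under any function. With
`S = K` this says that `cfc f S` commutes with everything that commutes with `S`. -/
theorem cfc_mul_of_intertwine (f : ℝ → ℝ) {S : Matrix κ κ ℂ} {K : Matrix ι ι ℂ}
    {V : Matrix κ ι ℂ} (hS : S.IsHermitian) (hK : K.IsHermitian) (h : S * V = V * K) :
    cfc f S * V = V * cfc f K := by
  obtain ⟨p, hp, hq⟩ := exists_polynomial_cfc f hS hK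
  rw [hp, hq, aeval_mul_of_intertwine p h]

theorem cfc_reindex (f : ℝ → ℝ) (e : ι ≃ κ) {S : Matrix ι ι ℂ} (hS : S.IsHermitian) :
    cfc f (S.submatrix e.symm e.symm) = (cfc f S).submatrix e.symm e.symm := by
  obtain ⟨p, hp, hq⟩ := exists_polynomial_cfc f hS (hS.submatrix e.symm)
  rw [hp, hq]
  exact Polynomial.aeval_algHom_apply (Matrix.reindexAlgEquiv ℝ ℂ e).toAlgHom S p

/-- Matrix monotonicity, postulated for the index types `Fin n`, holds for every finite index
type. -/
theorem MatrixMonotone.cfc_sub_cfc {f : ℝ → ℝ} (hf : MatrixMonotone f) {S T : Matrix ι ι ℂ}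
    (hS : S.PosDef) (hT : T.PosDef) (h : (T - S).PosSemidef) :
    (cfc f T - cfc f S).PosSemidef := by
  let e := Fintype.equivFin ι
  have := hf _ (S.submatrix e.symm e.symm) (T.submatrix e.symm e.symm)
    (hS.submatrix e.symm.injective) (hT.submatrix e.symm.injective) (h.submatrix e.symm)
  rw [cfc_reindex f e hS.1, cfc_reindex f e hT.1] at this
  exact (posSemidef_submatrix_equiv e.symm).mp this

open scoped MatrixOrder in
theorem posSemidef_cfc {f : ℝ → ℝ} {S : Matrix ι ι ℂ} (h : ∀ x ∈ spectrum ℝ S, 0 ≤ f x) :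
    (cfc f S).PosSemidef :=
  Matrix.nonneg_iff_posSemidef.mp (cfc_nonneg h)

theorem pos_of_mem_spectrum {S : Matrix ι ι ℂ} (hS : S.PosDef) {x : ℝ}
    (hx : x ∈ spectrum ℝ S) : 0 < x := by
  rw [hS.1.spectrum_real_eq_range_eigenvalues] at hx
  obtain ⟨i, rfl⟩ := hx
  exact hS.eigenvalues_pos i

theorem continuousOn_spectrum (f : ℝ → ℝ) (S : Matrix ι ι ℂ) :
    ContinuousOn f (spectrum ℝ S) := S.finite_real_spectrum.continuousOn f

open scoped MatrixOrder in
theorem posDef_cfc {f : ℝ → ℝ} {S : Matrix ι ι ℂ} (hS : S.PosDef)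
    (hpos : ∀ x : ℝ, 0 < x → 0 < f x) : (cfc f S).PosDef := by
  have h : ∀ x ∈ spectrum ℝ S, 0 < f x := fun x hx => hpos x (pos_of_mem_spectrum hS hx)
  refine (posSemidef_cfc fun x hx => (h x hx).le).posDef_iff_isUnit.mpr ?_
  exact (isUnit_cfc_iff f S (continuousOn_spectrum f S) hS.1.isSelfAdjoint).mpr
    fun x hx => (h x hx).ne'

/-! ### Jensen's inequality for matrix monotone functions -/

/-- When `P` is an orthogonal projection, this bounds `T` by multiples of its two diagonal blocks;
the difference is `(√ε P - (1 - P)/√ε)* T (√ε P - (1 - P)/√ε)`. -/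
theorem posSemidef_pinching {T P : Matrix κ κ ℂ} (hT : T.PosSemidef) (hP : P.IsHermitian)
    {ε : ℝ} (hε : 0 < ε) :
    ((1 + ε) • (P * T * P) + (1 + ε⁻¹) • ((1 - P) * T * (1 - P)) - T).PosSemidef := by
  have hQ : (1 - P).IsHermitian := isHermitian_one.sub hP
  have hs : √ε * √ε = ε := Real.mul_self_sqrt hε.le
  have hs0 : √ε ≠ 0 := (Real.sqrt_pos.mpr hε).ne'
  have hsi : (√ε)⁻¹ * (√ε)⁻¹ = ε⁻¹ := by rw [← mul_inv, hs]
  have h := hT.conjTranspose_mul_mul_same (√ε • P - (√ε)⁻¹ • (1 - P))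
  have hH : (√ε • P - (√ε)⁻¹ • (1 - P))ᴴ = √ε • P - (√ε)⁻¹ • (1 - P) := by
    rw [conjTranspose_sub, conjTranspose_smul, conjTranspose_smul, hP.eq, hQ.eq]; simp
  rw [hH] at h
  convert h using 1
  have hdecomp : T = P * T * P + P * T * (1 - P) + (1 - P) * T * P + (1 - P) * T * (1 - P) := by
    noncomm_ring
  generalize 1 - P = Q at *
  have key : ∀ W, W = P * T * P + P * T * Q + Q * T * P + Q * T * Q →
      (1 + ε) • (P * T * P) + (1 + ε⁻¹) • (Q * T * Q) - W =
        (√ε • P - (√ε)⁻¹ • Q) * T * (√ε • P - (√ε)⁻¹ • Q) := by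
    rintro W rfl
    simp only [sub_mul, mul_sub, Matrix.smul_mul, Matrix.mul_smul, smul_smul,
      hs, hsi, mul_inv_cancel₀ hs0, inv_mul_cancel₀ hs0, add_smul, one_smul]
    abel
  exact key T hdecomp

/-- Jensen's inequality for an isometry `V`, with a spurious factor `1 + ε`. The upper bound for `T`
given by pinching along the range of `V` is intertwined by `V` with `(1 + ε) V* T V`, and therefore
so are the images under `f`. -/
theorem MatrixMonotone.jensen_dilated (hf : MatrixMonotone f) {T : Matrix κ κ ℂ} (hT : T.PosDef)
    {V : Matrix κ ι ℂ} (hV : Vᴴ * V = 1) {ε : ℝ} (hε : 0 < ε) :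
    (cfc f ((1 + ε) • (Vᴴ * T * V)) - Vᴴ * cfc f T * V).PosSemidef := by
  set P := V * Vᴴ with hPdef
  have hP : P.IsHermitian := isHermitian_mul_conjTranspose_self V
  set S := (1 + ε) • (P * T * P) + (1 + ε⁻¹) • ((1 - P) * T * (1 - P)) with hSdef
  have hST : (S - T).PosSemidef := posSemidef_pinching hT.posSemidef hP hε
  have hS : S.PosDef := by simpa using hT.add_posSemidef hST
  have hPV : P * V = V := by rw [hPdef, Matrix.mul_assoc, hV, Matrix.mul_one]
  -- `1 - P` annihilates the columns of `V`, so only the first block of `S` acts on them.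
  have hSV : S * V = V * ((1 + ε) • (Vᴴ * T * V)) := by
    simp only [hSdef, Matrix.add_mul, Matrix.smul_mul, Matrix.mul_assoc, hPV, Matrix.sub_mul,
      Matrix.one_mul, sub_self, Matrix.mul_zero, smul_zero, add_zero, Matrix.mul_smul]
    simp [hPdef, Matrix.mul_assoc]
  have hK : ((1 + ε) • (Vᴴ * T * V)).IsHermitian := by
    have : (Vᴴ * T * V).IsHermitian := isHermitian_conjTranspose_mul_mul V hT.1
    rw [IsHermitian, conjTranspose_smul, this.eq]; simp
  have h := (hf.cfc_sub_cfc hT hS hST).conjTranspose_mul_mul_same V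
  rwa [Matrix.mul_sub, Matrix.sub_mul, Matrix.mul_assoc, cfc_mul_of_intertwine f hS.1 hK hSV,
    ← Matrix.mul_assoc, hV, Matrix.one_mul] at h

/-- The case of a diagonal `2 × 2` matrix and the isometry `(√a, √(1 - a))`. -/
theorem MatrixMonotone.two_point (hf : MatrixMonotone f) {x y a ε : ℝ} (hx : 0 < x)
    (hy : 0 < y) (ha : 0 ≤ a) (ha' : a ≤ 1) (hε : 0 < ε) :
    a * f x + (1 - a) * f y ≤ f ((1 + ε) * (a * x + (1 - a) * y)) := by
  have hdiag : ∀ d : Fin 2 → ℝ, cfc f (diagonal fun i => (d i : ℂ)) =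
      diagonal fun i => ((f (d i) : ℝ) : ℂ) := by
    intro d
    have hd : (diagonal fun i => (d i : ℂ)).IsHermitian :=
      isHermitian_diagonal_of_self_adjoint _ (by ext i; simp)
    obtain ⟨p, hp⟩ := exists_polynomial_eqOn
      ((Set.finite_range d).union (diagonal fun i => (d i : ℂ)).finite_real_spectrum) f
    rw [← cfc_congr fun x hx => hp x (Or.inr hx), cfc_polynomial p _ hd.isSelfAdjoint]
    have := Polynomial.aeval_algHom_apply (Matrix.diagonalAlgHom ℝ (n := Fin 2) (α := ℂ))
      (fun i => (d i : ℂ)) p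
    simp only [diagonalAlgHom_apply] at this
    rw [this]
    congr 1
    ext i
    rw [show (aeval (fun i => (d i : ℂ)) p) i = aeval (d i : ℂ) p from
      (Polynomial.aeval_algHom_apply (Pi.evalAlgHom ℝ (fun _ : Fin 2 => ℂ) i) _ p).symm,
      ← hp (d i) (Or.inl ⟨i, rfl⟩)]
    exact Polynomial.aeval_algebraMap_apply ℂ (d i) p
  have hs : (√a : ℂ) * √a = a := by rw [← Complex.ofReal_mul, Real.mul_self_sqrt ha]
  have hs' : (√(1 - a) : ℂ) * √(1 - a) = 1 - a := by
    rw [← Complex.ofReal_mul, Real.mul_self_sqrt (by linarith)]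
    simp
  let V : Matrix (Fin 2) (Fin 1) ℂ := !![(√a : ℂ); (√(1 - a) : ℂ)]
  let d : Fin 2 → ℝ := ![x, y]
  have hform : ∀ u : Fin 2 → ℝ, Vᴴ * (diagonal fun i => (u i : ℂ)) * V =
      algebraMap ℝ _ (a * u 0 + (1 - a) * u 1) := by
    intro u
    ext i j
    fin_cases i; fin_cases j
    simp only [V, Matrix.mul_apply, Fin.sum_univ_two, diagonal, Matrix.algebraMap_matrix_apply]
    simp
    linear_combination (u 0 : ℂ) * hs + (u 1 : ℂ) * hs'
  have hV : Vᴴ * V = 1 := by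
    have := hform (fun _ => 1)
    simpa using this
  have hd : (diagonal fun i => (d i : ℂ)).PosDef := by
    refine PosDef.diagonal fun i => ?_
    fin_cases i <;> simpa [d]
  have h := hf.jensen_dilated hd hV hε
  rw [hdiag, hform, hform, Algebra.smul_def, ← map_mul, cfc_algebraMap, ← map_sub] at h
  have h0 := h.diag_nonneg (i := 0)
  rw [Matrix.algebraMap_matrix_apply, if_pos rfl] at h0
  simpa [d, ← Complex.ofReal_mul] using Complex.zero_le_real.mp h0

/-- A positive matrix monotone function satisfies `f x / x ≤ f t / t` for `t ≤ x`: in the two-point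
inequality the term of the second point is positive and can be dropped. -/
theorem MatrixMonotone.div_mul_le (hf : MatrixMonotone f) (hpos : ∀ x : ℝ, 0 < x → 0 < f x)
    {t x : ℝ} (ht : 0 < t) (htx : t ≤ x) : t / x * f x ≤ f t := by
  have hx : 0 < x := ht.trans_le htx
  rw [← le_div_iff₀ (hpos x hx)]
  refine le_of_forall_lt_imp_le_of_dense fun a ha => ?_
  rw [le_div_iff₀ (hpos x hx)]
  rcases le_or_gt a 0 with h0 | h0
  · nlinarith [hpos x hx, hpos t ht]
  have hax : a * x < t := (lt_div_iff₀ hx).mp ha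
  have ha1 : a < 1 := ha.trans_le ((div_le_one hx).mpr htx)
  -- The second point and `ε` are chosen so that `1 + ε = 2 t / (t + a x)` and the argument of `f`
  -- in the two-point inequality is exactly `t`.
  have hy : 0 < (t - a * x) / (2 * (1 - a)) := div_pos (by linarith) (by linarith)
  have hs : 0 < t + a * x := by positivity
  have h := hf.two_point hx hy h0.le ha1.le (ε := (t - a * x) / (t + a * x))
    (div_pos (by linarith) hs)
  have e : (1 + (t - a * x) / (t + a * x)) *
      (a * x + (1 - a) * ((t - a * x) / (2 * (1 - a)))) = t := by
    have : 1 - a ≠ 0 := by linarith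
    field_simp
    ring
  rw [e] at h
  have := mul_pos (sub_pos.mpr ha1) (hpos _ hy)
  linarith

omit [DecidableEq ι] in
theorem posSemidef_of_forall_add_smul {M N : Matrix ι ι ℂ}
    (h : ∀ ε : ℝ, 0 < ε → (M + ε • N).PosSemidef) (hN : N.IsHermitian) : M.PosSemidef := by
  have hM : M.IsHermitian := by
    have := (h 1 one_pos).1.sub hN
    simpa using this
  refine .of_dotProduct_mulVec_nonneg hM fun x => ?_
  have hlim : Filter.Tendsto (fun ε : ℝ => star x ⬝ᵥ ((M + ε • N) *ᵥ x))
      (nhdsWithin 0 (Set.Ioi 0)) (nhds (star x ⬝ᵥ (M *ᵥ x))) := by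
    have hc : Continuous fun ε : ℝ => star x ⬝ᵥ ((M + ε • N) *ᵥ x) := by fun_prop
    simpa using (hc.tendsto 0).mono_left nhdsWithin_le_nhds
  refine ge_of_tendsto hlim ?_
  filter_upwards [self_mem_nhdsWithin] with ε hε
  exact (h ε hε).dotProduct_mulVec_nonneg x

/-- Jensen's inequality for a positive matrix monotone function and an isometry `V`. The factor
`1 + ε` leaves the argument of `f` by `MatrixMonotone.div_mul_le` and then tends to `1`, so that
continuity of `f` is not needed. -/
theorem MatrixMonotone.jensen (hf : MatrixMonotone f) (hpos : ∀ x : ℝ, 0 < x → 0 < f x)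
    {T : Matrix κ κ ℂ} (hT : T.PosDef) {V : Matrix κ ι ℂ} (hV : Vᴴ * V = 1) :
    (cfc f (Vᴴ * T * V) - Vᴴ * cfc f T * V).PosSemidef := by
  have hK : (Vᴴ * T * V).PosDef := hT.conjTranspose_mul_mul_same <| by
    refine Function.LeftInverse.injective (g := Vᴴ.mulVec) fun x => ?_
    rw [mulVec_mulVec, hV, one_mulVec]
  refine posSemidef_of_forall_add_smul (N := cfc f (Vᴴ * T * V)) (fun ε hε => ?_)
    (posDef_cfc hK hpos).1
  have hε' : 0 < 1 + ε := by linarith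
  have h1 := hf.jensen_dilated hT hV hε
  set K := Vᴴ * T * V
  -- Scalar inequality `f ((1 + ε) x) ≤ (1 + ε) f x` on the spectrum of `K`.
  have h2 : ((1 + ε) • cfc f K - cfc f ((1 + ε) • K)).PosSemidef := by
    rw [← cfc_comp_const_mul (1 + ε) f K (Set.Finite.continuousOn
        (K.finite_real_spectrum.image _) f) hK.1.isSelfAdjoint,
      ← cfc_const_mul (1 + ε) f K (continuousOn_spectrum _ K),
      ← cfc_sub _ _ K (continuousOn_spectrum _ K) (continuousOn_spectrum _ K)]
    refine posSemidef_cfc fun x hx => ?_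
    have hx := pos_of_mem_spectrum hK hx
    have h := hf.div_mul_le hpos hx (x := (1 + ε) * x) (by nlinarith)
    have e : x / ((1 + ε) * x) = (1 + ε)⁻¹ := by field_simp
    rw [e, inv_mul_le_iff₀ hε'] at h
    linarith
  convert h1.add h2 using 1
  rw [add_smul 1 ε (cfc f K), one_smul]
  abel

omit [DecidableEq ι] [DecidableEq κ] in
theorem posDef_fromBlocks_zero {T₁ : Matrix ι ι ℂ} {T₂ : Matrix κ κ ℂ} (h₁ : T₁.PosDef)
    (h₂ : T₂.PosDef) : (fromBlocks T₁ 0 0 T₂).PosDef := by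
  refine .of_dotProduct_mulVec_pos (IsHermitian.fromBlocks h₁.1 (by simp) h₂.1) fun x hx => ?_
  have e : star x ⬝ᵥ (fromBlocks T₁ 0 0 T₂ *ᵥ x) =
      star (x ∘ Sum.inl) ⬝ᵥ (T₁ *ᵥ (x ∘ Sum.inl)) +
      star (x ∘ Sum.inr) ⬝ᵥ (T₂ *ᵥ (x ∘ Sum.inr)) := by
    rw [fromBlocks_mulVec]
    simp [dotProduct, Fintype.sum_sum_type]
  rw [e]
  by_cases h0 : x ∘ Sum.inl = 0
  · have h0' : x ∘ Sum.inr ≠ 0 := fun h => hx <| by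
      ext (i | i)
      · exact congrFun h0 i
      · exact congrFun h i
    exact add_pos_of_nonneg_of_pos (h₁.posSemidef.dotProduct_mulVec_nonneg _)
      (h₂.dotProduct_mulVec_pos h0')
  · exact add_pos_of_pos_of_nonneg (h₁.dotProduct_mulVec_pos h0)
      (h₂.posSemidef.dotProduct_mulVec_nonneg _)

theorem cfc_fromBlocks_zero {T₁ : Matrix ι ι ℂ} {T₂ : Matrix κ κ ℂ} (h₁ : T₁.IsHermitian)
    (h₂ : T₂.IsHermitian) :
    cfc f (fromBlocks T₁ 0 0 T₂) = fromBlocks (cfc f T₁) 0 0 (cfc f T₂) := by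
  have hT : (fromBlocks T₁ 0 0 T₂).IsHermitian := h₁.fromBlocks (by simp) h₂
  have e₁ := cfc_mul_of_intertwine f (V := fromRows (1 : Matrix ι ι ℂ) (0 : Matrix κ ι ℂ)) hT h₁
    (by simp [fromBlocks_mul_fromRows, fromRows_mul])
  have e₂ := cfc_mul_of_intertwine f (V := fromRows (0 : Matrix ι κ ℂ) (1 : Matrix κ κ ℂ)) hT h₂
    (by simp [fromBlocks_mul_fromRows, fromRows_mul])
  rw [← fromBlocks_toBlocks (cfc f (fromBlocks T₁ 0 0 T₂))] at e₁ e₂ ⊢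
  simp only [fromBlocks_mul_fromRows, fromRows_mul, Matrix.mul_one, Matrix.mul_zero, Matrix.one_mul,
    Matrix.zero_mul, add_zero, zero_add] at e₁ e₂
  obtain ⟨h₁₁, h₂₁⟩ := fromRows_inj e₁
  obtain ⟨h₁₂, h₂₂⟩ := fromRows_inj e₂
  rw [h₁₁, h₂₁, h₁₂, h₂₂]

/-- Jensen's inequality for two matrices, whose block-diagonal sum is compressed by the isometry with
block rows `V₁`, `V₂`. -/
theorem MatrixMonotone.jensen_two (hf : MatrixMonotone f) (hpos : ∀ x : ℝ, 0 < x → 0 < f x)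
    {T₁ T₂ V₁ V₂ : Matrix ι ι ℂ} (h₁ : T₁.PosDef) (h₂ : T₂.PosDef)
    (hV : V₁ᴴ * V₁ + V₂ᴴ * V₂ = 1) :
    (cfc f (V₁ᴴ * T₁ * V₁ + V₂ᴴ * T₂ * V₂) -
      (V₁ᴴ * cfc f T₁ * V₁ + V₂ᴴ * cfc f T₂ * V₂)).PosSemidef := by
  have h := hf.jensen hpos (posDef_fromBlocks_zero h₁ h₂) (V := fromRows V₁ V₂)
    (by rw [conjTranspose_fromRows_eq_fromCols_conjTranspose, fromCols_mul_fromRows, hV])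
  rw [cfc_fromBlocks_zero h₁.1 h₂.1] at h
  simpa [conjTranspose_fromRows_eq_fromCols_conjTranspose, Matrix.mul_assoc,
    fromBlocks_mul_fromRows, fromCols_mul_fromRows] using h

/-! ### Joint concavity of the perspective -/

theorem exists_posDef_sqrt {Y : Matrix ι ι ℂ} (hY : Y.PosDef) :
    ∃ W : Matrix ι ι ℂ, W.PosDef ∧ W * W = Y ∧ ∀ Z : Matrix ι ι ℂ, Commute Y Z → Commute W Z := by
  refine ⟨cfc Real.sqrt Y, posDef_cfc hY fun x hx => Real.sqrt_pos.mpr hx, ?_, fun Z hZ =>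
    cfc_mul_of_intertwine _ hY.1 hY.1 hZ⟩
  rw [← cfc_mul _ _ Y (continuousOn_spectrum _ Y) (continuousOn_spectrum _ Y)]
  conv_rhs => rw [← cfc_id ℝ Y hY.1.isSelfAdjoint]
  exact cfc_congr fun x hx => Real.mul_self_sqrt (pos_of_mem_spectrum hY hx).le

theorem commute_nonsing_inv {X Y : Matrix ι ι ℂ} (h : Commute X Y) : Commute X Y⁻¹ := by
  simpa using Matrix.Commute.zpow_right h (-1)

theorem posDef_mul_of_commute {X Y : Matrix ι ι ℂ} (hX : X.PosDef) (hY : Y.PosDef)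
    (h : Commute X Y) : (X * Y).PosDef := by
  obtain ⟨W, hW, hWY, hcomm⟩ := exists_posDef_sqrt hY
  have := (IsUnit.posDef_star_left_conjugate_iff hW.isUnit).mpr hX
  rwa [star_eq_conjTranspose, hW.1.eq, (hcomm X h.symm).eq, Matrix.mul_assoc, hWY] at this

/-- The perspective `f(X Y⁻¹) Y` of `f` at a pair of commuting positive definite matrices. For
non-commuting `X` and `Y` the matrix `X Y⁻¹` need not be Hermitian and the value has no meaning. -/
def perspective (f : ℝ → ℝ) (X Y : Matrix ι ι ℂ) : Matrix ι ι ℂ :=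
  cfc f (X * Y⁻¹) * Y

theorem posDef_perspective (hpos : ∀ x : ℝ, 0 < x → 0 < f x) {X Y : Matrix ι ι ℂ}
    (hX : X.PosDef) (hY : Y.PosDef) (h : Commute X Y) : (perspective f X Y).PosDef := by
  have hT := posDef_mul_of_commute hX hY.inv (commute_nonsing_inv h)
  have hTY : Commute (X * Y⁻¹) Y := h.mul_left (commute_nonsing_inv (Commute.refl Y)).symm
  exact posDef_mul_of_commute (posDef_cfc hT hpos) hY (cfc_mul_of_intertwine f hT.1 hT.1 hTY)

omit [DecidableEq ι] in
theorem conjTranspose_mul_mul_smul_mul {U W M : Matrix ι ι ℂ} (hU : U.IsHermitian)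
    (hW : W.IsHermitian) {a : ℝ} (ha : 0 ≤ a) :
    (√a • (U * W))ᴴ * M * (√a • (U * W)) = a • (W * (U * M * U) * W) := by
  rw [conjTranspose_smul, conjTranspose_mul, hU.eq, hW.eq, star_trivial]
  simp only [Matrix.smul_mul, Matrix.mul_smul, smul_smul, Real.mul_self_sqrt ha, Matrix.mul_assoc]

theorem sqrt_conj_perspective {X Y W : Matrix ι ι ℂ} (hX : X.PosDef) (hY : Y.PosDef)
    (h : Commute X Y) (hWY : W * W = Y) (hW : ∀ Z, Commute Y Z → Commute W Z) :
    W * (X * Y⁻¹) * W = X ∧ W * cfc f (X * Y⁻¹) * W = perspective f X Y := by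
  have hT := posDef_mul_of_commute hX hY.inv (commute_nonsing_inv h)
  have hTY : Commute (X * Y⁻¹) Y := h.mul_left (commute_nonsing_inv (Commute.refl Y)).symm
  have hfT : Commute (cfc f (X * Y⁻¹)) Y := cfc_mul_of_intertwine f hT.1 hT.1 hTY
  constructor
  · rw [(hW _ hTY.symm).eq, Matrix.mul_assoc, hWY, Matrix.mul_assoc,
      Matrix.nonsing_inv_mul _ ((isUnit_iff_isUnit_det _).mp hY.isUnit), Matrix.mul_one]
  · rw [(hW _ hfT.symm).eq, Matrix.mul_assoc, hWY, perspective]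

/-- Joint concavity of the perspective. This is Jensen's inequality for the matrices `Xᵢ Yᵢ⁻¹` with
the weights `√a Y₁^{1/2} Y^{-1/2}` and `√b Y₂^{1/2} Y^{-1/2}`, multiplied by `Y^{1/2}` on both
sides. -/
theorem MatrixMonotone.perspective_concave (hf : MatrixMonotone f)
    (hpos : ∀ x : ℝ, 0 < x → 0 < f x) {X₁ Y₁ X₂ Y₂ X Y : Matrix ι ι ℂ}
    (hX₁ : X₁.PosDef) (hY₁ : Y₁.PosDef) (hX₂ : X₂.PosDef) (hY₂ : Y₂.PosDef)
    (hX : X.PosDef) (hY : Y.PosDef)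
    (h₁ : Commute X₁ Y₁) (h₂ : Commute X₂ Y₂) (h : Commute X Y) {a b : ℝ} (ha : 0 ≤ a)
    (hb : 0 ≤ b) (hXe : X = a • X₁ + b • X₂) (hYe : Y = a • Y₁ + b • Y₂) :
    (perspective f X Y - (a • perspective f X₁ Y₁ + b • perspective f X₂ Y₂)).PosSemidef := by
  obtain ⟨W₁, hW₁, hWY₁, hc₁⟩ := exists_posDef_sqrt hY₁
  obtain ⟨W₂, hW₂, hWY₂, hc₂⟩ := exists_posDef_sqrt hY₂
  obtain ⟨W, hW, hWY, hc⟩ := exists_posDef_sqrt hY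
  have hdet := (isUnit_iff_isUnit_det _).mp hW.isUnit
  have hconj : ∀ Z, W * (W⁻¹ * Z * W⁻¹) * W = Z := fun Z => by
    rw [Matrix.mul_assoc, Matrix.mul_assoc, Matrix.nonsing_inv_mul _ hdet, Matrix.mul_one,
      ← Matrix.mul_assoc, Matrix.mul_nonsing_inv _ hdet, Matrix.one_mul]
  have hsum : ∀ M₁ M₂ : Matrix ι ι ℂ,
      a • (W⁻¹ * M₁ * W⁻¹) + b • (W⁻¹ * M₂ * W⁻¹) = W⁻¹ * (a • M₁ + b • M₂) * W⁻¹ :=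
    fun M₁ M₂ => by
      simp only [Matrix.mul_add, Matrix.add_mul, Matrix.smul_mul, Matrix.mul_smul]
  have hT₁ := posDef_mul_of_commute hX₁ hY₁.inv (commute_nonsing_inv h₁)
  have hT₂ := posDef_mul_of_commute hX₂ hY₂.inv (commute_nonsing_inv h₂)
  have hV : (√a • (W₁ * W⁻¹))ᴴ * (√a • (W₁ * W⁻¹)) +
      (√b • (W₂ * W⁻¹))ᴴ * (√b • (W₂ * W⁻¹)) = 1 := by
    have e₁ := conjTranspose_mul_mul_smul_mul (M := 1) hW₁.1 hW.inv.1 ha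
    have e₂ := conjTranspose_mul_mul_smul_mul (M := 1) hW₂.1 hW.inv.1 hb
    rw [Matrix.mul_one, Matrix.mul_one] at e₁ e₂
    rw [e₁, e₂, hsum, hWY₁, hWY₂, ← hYe, ← hWY, ← Matrix.mul_assoc,
      Matrix.nonsing_inv_mul _ hdet, Matrix.one_mul, Matrix.mul_nonsing_inv _ hdet]
  have hXW : W⁻¹ * X * W⁻¹ = X * Y⁻¹ := by
    rw [(commute_nonsing_inv (hc X h.symm).symm).symm.eq, Matrix.mul_assoc,
      ← Matrix.mul_inv_rev, hWY]
  have key := hf.jensen_two hpos hT₁ hT₂ hV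
  have s₁ := sqrt_conj_perspective (f := f) hX₁ hY₁ h₁ hWY₁ hc₁
  have s₂ := sqrt_conj_perspective (f := f) hX₂ hY₂ h₂ hWY₂ hc₂
  rw [conjTranspose_mul_mul_smul_mul hW₁.1 hW.inv.1 ha,
    conjTranspose_mul_mul_smul_mul hW₂.1 hW.inv.1 hb,
    conjTranspose_mul_mul_smul_mul hW₁.1 hW.inv.1 ha,
    conjTranspose_mul_mul_smul_mul hW₂.1 hW.inv.1 hb, hsum, hsum,
    s₁.1, s₁.2, s₂.1, s₂.2, ← hXe, hXW] at key
  have := key.conjTranspose_mul_mul_same W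
  rwa [hW.1.eq, Matrix.mul_sub, Matrix.sub_mul, hconj,
    (sqrt_conj_perspective hX hY h hWY hc).2] at this

/-! ### Convexity of the quadratic form of the inverse -/

/-- The left side is a concave function of `x` with maximum at `x = J⁻¹ v`, where equality holds. -/
theorem two_re_sub_le {J : Matrix ι ι ℂ} (hJ : J.PosDef) (v x : ι → ℂ) :
    2 * (star x ⬝ᵥ v).re - (star x ⬝ᵥ (J *ᵥ x)).re ≤ (star v ⬝ᵥ (J⁻¹ *ᵥ v)).re := by
  have hdet := (isUnit_iff_isUnit_det _).mp hJ.isUnit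
  have h := hJ.posSemidef.dotProduct_mulVec_nonneg (x - J⁻¹ *ᵥ v)
  have e : star (J⁻¹ *ᵥ v) ⬝ᵥ (J *ᵥ x) = star v ⬝ᵥ x := by
    rw [star_mulVec, hJ.inv.1.eq, dotProduct_mulVec, vecMul_vecMul,
      Matrix.nonsing_inv_mul _ hdet, vecMul_one]
  have e' : star (J⁻¹ *ᵥ v) ⬝ᵥ v = star v ⬝ᵥ (J⁻¹ *ᵥ v) := by
    rw [star_mulVec, hJ.inv.1.eq, dotProduct_mulVec]
  have e'' : (star v ⬝ᵥ x).re = (star x ⬝ᵥ v).re := by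
    rw [star_dotProduct, Complex.star_def, Complex.conj_re]
  rw [star_sub, mulVec_sub, mulVec_mulVec, Matrix.mul_nonsing_inv _ hdet, one_mulVec,
    sub_dotProduct, dotProduct_sub, dotProduct_sub, e, e'] at h
  have := (Complex.le_def.mp h).1
  simp only [Complex.sub_re, Complex.zero_re] at this
  linarith

/-- `J ↦ ⟨v, J⁻¹ v⟩` is decreasing and convex, being a supremum of affine functions of `J`. -/
theorem re_dotProduct_inv_le {J₁ J₂ J : Matrix ι ι ℂ} (h₁ : J₁.PosDef) (h₂ : J₂.PosDef)
    (hJ : J.PosDef) {a b : ℝ} (ha : 0 ≤ a) (hb : 0 ≤ b) (hab : a + b = 1)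
    (h : (J - (a • J₁ + b • J₂)).PosSemidef) (v : ι → ℂ) :
    (star v ⬝ᵥ (J⁻¹ *ᵥ v)).re ≤
      a * (star v ⬝ᵥ (J₁⁻¹ *ᵥ v)).re + b * (star v ⬝ᵥ (J₂⁻¹ *ᵥ v)).re := by
  have hdet := (isUnit_iff_isUnit_det _).mp hJ.isUnit
  set x := J⁻¹ *ᵥ v with hx
  have hxJ : (star x ⬝ᵥ (J *ᵥ x)).re = (star x ⬝ᵥ v).re := by
    rw [hx, mulVec_mulVec, Matrix.mul_nonsing_inv _ hdet, one_mulVec]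
  have hxv : star x ⬝ᵥ v = star v ⬝ᵥ x := by
    rw [hx, star_mulVec, hJ.inv.1.eq, dotProduct_mulVec]
  have hle := (Complex.le_def.mp (h.dotProduct_mulVec_nonneg x)).1
  simp only [sub_mulVec, add_mulVec, smul_mulVec, dotProduct_sub, dotProduct_add, dotProduct_smul,
    Complex.sub_re, Complex.add_re, Complex.real_smul, Complex.re_ofReal_mul, Complex.zero_re]
    at hle
  have k₁ := mul_le_mul_of_nonneg_left (two_re_sub_le h₁ v x) ha
  have k₂ := mul_le_mul_of_nonneg_left (two_re_sub_le h₂ v x) hb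
  rw [← hxv]
  have : (star x ⬝ᵥ v).re = (a + b) * (star x ⬝ᵥ v).re := by rw [hab, one_mul]
  linarith

/-! ### Matrices of the operators in the basis of matrix units -/

theorem toMatrix_stdBasis_mulLeft (D : Matrix (Fin n) (Fin n) ℂ) :
    LinearMap.toMatrix (Matrix.stdBasis ℂ (Fin n) (Fin n)) (Matrix.stdBasis ℂ (Fin n) (Fin n))
      (LinearMap.mulLeft ℂ D) = kroneckerMap (· * ·) D 1 := by
  ext ⟨i, j⟩ ⟨k, l⟩
  rw [LinearMap.toMatrix_apply, Matrix.stdBasis_eq_single, LinearMap.mulLeft_apply]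
  simp [Matrix.stdBasis, Matrix.mul_apply, Matrix.single_apply, Matrix.one_apply, ite_and, eq_comm]

theorem toMatrix_stdBasis_mulRight (D : Matrix (Fin n) (Fin n) ℂ) :
    LinearMap.toMatrix (Matrix.stdBasis ℂ (Fin n) (Fin n)) (Matrix.stdBasis ℂ (Fin n) (Fin n))
      (LinearMap.mulRight ℂ D) = kroneckerMap (· * ·) 1 Dᵀ := by
  ext ⟨i, j⟩ ⟨k, l⟩
  rw [LinearMap.toMatrix_apply, Matrix.stdBasis_eq_single, LinearMap.mulRight_apply]
  simp [Matrix.stdBasis, Matrix.mul_apply, Matrix.single_apply, Matrix.one_apply, ite_and, eq_comm]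

theorem hsInner_eq_dotProduct (B C : Matrix (Fin n) (Fin n) ℂ) :
    hsInner B C = star ⇑((Matrix.stdBasis ℂ (Fin n) (Fin n)).repr B) ⬝ᵥ
      ⇑((Matrix.stdBasis ℂ (Fin n) (Fin n)).repr C) := by
  simp only [hsInner, Matrix.trace, Matrix.diag, Matrix.mul_apply, dotProduct,
    Fintype.sum_prod_type]
  rw [Finset.sum_comm]
  simp [Matrix.stdBasis]

theorem commute_kronecker (D₁ D₂ : Matrix (Fin n) (Fin n) ℂ) :
    Commute (D₁ ⊗ₖ (1 : Matrix (Fin n) (Fin n) ℂ)) ((1 : Matrix (Fin n) (Fin n) ℂ) ⊗ₖ D₂ᵀ) := by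
  rw [Commute, SemiconjBy, ← mul_kronecker_mul, ← mul_kronecker_mul]
  simp

/-- The matrix of `opJ f D₁ D₂` in the basis of matrix units, in which left multiplication by `D₁`
is `D₁ ⊗ 1` and right multiplication by `D₂` is `1 ⊗ D₂ᵀ`; see `opJ_eq_toLin`. -/
def matrixJ (f : ℝ → ℝ) (D₁ D₂ : Matrix (Fin n) (Fin n) ℂ) :
    Matrix (Fin n × Fin n) (Fin n × Fin n) ℂ :=
  perspective f (D₁ ⊗ₖ 1) (1 ⊗ₖ D₂ᵀ)

theorem posDef_matrixJ (hpos : ∀ x : ℝ, 0 < x → 0 < f x) {D₁ D₂ : Matrix (Fin n) (Fin n) ℂ}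
    (h₁ : D₁.PosDef) (h₂ : D₂.PosDef) : (matrixJ f D₁ D₂).PosDef :=
  posDef_perspective hpos (h₁.kronecker .one) (PosDef.one.kronecker h₂.transpose)
    (commute_kronecker D₁ D₂)

theorem opJ_eq_toLin (D₁ D₂ : Matrix (Fin n) (Fin n) ℂ) :
    opJ f D₁ D₂ = Matrix.toLin (Matrix.stdBasis ℂ (Fin n) (Fin n))
      (Matrix.stdBasis ℂ (Fin n) (Fin n)) (matrixJ f D₁ D₂) := by
  rw [opJ, opFun, relModular, matrixJ, perspective,
    Matrix.toLin_mul _ (Matrix.stdBasis ℂ (Fin n) (Fin n)),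
    LinearMap.toMatrix_mul, toMatrix_stdBasis_mulLeft, toMatrix_stdBasis_mulRight,
    ← toMatrix_stdBasis_mulRight D₂, Matrix.toLin_toMatrix, toMatrix_stdBasis_mulRight,
    inv_kronecker, inv_one, transpose_nonsing_inv]
  rfl

theorem isUnit_opJ (hpos : ∀ x : ℝ, 0 < x → 0 < f x) {D₁ D₂ : Matrix (Fin n) (Fin n) ℂ}
    (h₁ : D₁.PosDef) (h₂ : D₂.PosDef) : IsUnit (opJ f D₁ D₂) := by
  rw [opJ_eq_toLin]
  exact (posDef_matrixJ hpos h₁ h₂).isUnit.map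
    (Matrix.toLinAlgEquiv (Matrix.stdBasis ℂ (Fin n) (Fin n)))

theorem genMetric_eq (hpos : ∀ x : ℝ, 0 < x → 0 < f x) {D₁ D₂ : Matrix (Fin n) (Fin n) ℂ}
    (h₁ : D₁.PosDef) (h₂ : D₂.PosDef) (A : Matrix (Fin n) (Fin n) ℂ) :
    genMetric f D₁ D₂ A A = star ⇑((Matrix.stdBasis ℂ (Fin n) (Fin n)).repr A) ⬝ᵥ
      ((matrixJ f D₁ D₂)⁻¹ *ᵥ ⇑((Matrix.stdBasis ℂ (Fin n) (Fin n)).repr A)) := by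
  have hdet := (isUnit_iff_isUnit_det _).mp (posDef_matrixJ hpos h₁ h₂).isUnit
  have hinv : Ring.inverse (opJ f D₁ D₂) = Matrix.toLin (Matrix.stdBasis ℂ (Fin n) (Fin n))
      (Matrix.stdBasis ℂ (Fin n) (Fin n)) (matrixJ f D₁ D₂)⁻¹ := by
    refine (left_inv_eq_right_inv ?_ (Ring.mul_inverse_cancel _ (isUnit_opJ hpos h₁ h₂))).symm
    rw [opJ_eq_toLin]
    have := Matrix.toLin_mul (Matrix.stdBasis ℂ (Fin n) (Fin n)) (Matrix.stdBasis ℂ (Fin n) (Fin n))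
      (Matrix.stdBasis ℂ (Fin n) (Fin n)) (matrixJ f D₁ D₂)⁻¹ (matrixJ f D₁ D₂)
    rw [Matrix.nonsing_inv_mul _ hdet, Matrix.toLin_one] at this
    exact this.symm
  rw [genMetric, hsInner_eq_dotProduct, hinv, Matrix.repr_toLin]

theorem posDef_convexComb {X Y : Matrix (Fin n) (Fin n) ℂ} (hX : X.PosDef) (hY : Y.PosDef)
    {a b : ℝ} (ha : 0 ≤ a) (hb : 0 ≤ b) (hab : a + b = 1) : (a • X + b • Y).PosDef := by
  rcases ha.eq_or_lt with rfl | ha'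
  · obtain rfl : b = 1 := by linarith
    simpa using hY
  · exact (hX.smul ha').add_posSemidef (hY.posSemidef.smul hb)

theorem MatrixMonotone.matrixJ_concave (hf : MatrixMonotone f)
    (hpos : ∀ x : ℝ, 0 < x → 0 < f x) {D₁ D₂ E₁ E₂ : Matrix (Fin n) (Fin n) ℂ}
    (hD₁ : D₁.PosDef) (hD₂ : D₂.PosDef) (hE₁ : E₁.PosDef) (hE₂ : E₂.PosDef)
    {a b : ℝ} (ha : 0 ≤ a) (hb : 0 ≤ b) (hab : a + b = 1) :
    (matrixJ f (a • D₁ + b • E₁) (a • D₂ + b • E₂) -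
      (a • matrixJ f D₁ D₂ + b • matrixJ f E₁ E₂)).PosSemidef :=
  hf.perspective_concave hpos (hD₁.kronecker .one) (PosDef.one.kronecker hD₂.transpose)
    (hE₁.kronecker .one) (PosDef.one.kronecker hE₂.transpose)
    ((posDef_convexComb hD₁ hE₁ ha hb hab).kronecker .one)
    (PosDef.one.kronecker (posDef_convexComb hD₂ hE₂ ha hb hab).transpose)
    (commute_kronecker _ _) (commute_kronecker _ _) (commute_kronecker _ _) ha hb
    (by rw [add_kronecker, smul_kronecker, smul_kronecker])
    (by rw [transpose_add, transpose_smul, transpose_smul, kronecker_add, kronecker_smul,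
      kronecker_smul])

end QuasiEntropy

end

theorem mainTheorem2 (f : ℝ → ℝ) (hpos : ∀ x : ℝ, 0 < x → 0 < f x)
    (hf : QuasiEntropy.MatrixMonotone f) (n : ℕ) (A : Matrix (Fin n) (Fin n) ℂ) :
    (∀ D₁ D₂ : Matrix (Fin n) (Fin n) ℂ, D₁.PosDef → D₂.PosDef →
      IsUnit (QuasiEntropy.opJ f D₁ D₂) ∧ (QuasiEntropy.genMetric f D₁ D₂ A A).im = 0) ∧
    ConvexOn ℝ
      {D : Matrix (Fin n) (Fin n) ℂ × Matrix (Fin n) (Fin n) ℂ | D.1.PosDef ∧ D.2.PosDef}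
      (fun D => (QuasiEntropy.genMetric f D.1 D.2 A A).re) := by
  refine ⟨fun D₁ D₂ h₁ h₂ => ⟨QuasiEntropy.isUnit_opJ hpos h₁ h₂, ?_⟩, ?_, ?_⟩
  · rw [QuasiEntropy.genMetric_eq hpos h₁ h₂]
    have h := (QuasiEntropy.posDef_matrixJ hpos h₁ h₂).inv.posSemidef.dotProduct_mulVec_nonneg
      ⇑((Matrix.stdBasis ℂ (Fin n) (Fin n)).repr A)
    exact (Complex.le_def.mp h).2.symm
  · rintro D ⟨hD₁, hD₂⟩ E ⟨hE₁, hE₂⟩ a b ha hb hab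
    exact ⟨QuasiEntropy.posDef_convexComb hD₁ hE₁ ha hb hab,
      QuasiEntropy.posDef_convexComb hD₂ hE₂ ha hb hab⟩
  · rintro D ⟨hD₁, hD₂⟩ E ⟨hE₁, hE₂⟩ a b ha hb hab
    have h₁ := QuasiEntropy.posDef_convexComb hD₁ hE₁ ha hb hab
    have h₂ := QuasiEntropy.posDef_convexComb hD₂ hE₂ ha hb hab
    simp only [smul_eq_mul, Prod.fst_add, Prod.snd_add, Prod.smul_fst, Prod.smul_snd]
    rw [QuasiEntropy.genMetric_eq hpos h₁ h₂, QuasiEntropy.genMetric_eq hpos hD₁ hD₂,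
      QuasiEntropy.genMetric_eq hpos hE₁ hE₂]
    exact QuasiEntropy.re_dotProduct_inv_le (QuasiEntropy.posDef_matrixJ hpos hD₁ hD₂)
      (QuasiEntropy.posDef_matrixJ hpos hE₁ hE₂) (QuasiEntropy.posDef_matrixJ hpos h₁ h₂)
      ha hb hab (hf.matrixJ_concave hpos hD₁ hD₂ hE₁ hE₂ ha hb hab) _
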